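/- Let $(M,d)$ be a complete metric space whose topology is discrete (every singleton is open), with a base point $0\in M$. Let $\mathrm{Lip}_0(M)$ be the space of all Lipschitz functions $f:M\to\mathbb{R}$ with $f(0)=0$, normed by the Lipschitz constant $\mathrm{Lip}(f)=\sup_{x\neq y}\frac{|f(x)-f(y)|}{d(x,y)}$, and let $\mathcal{F}(M)=\overline{\mathrm{span}}\{\delta(x):x\in M\}\subset \mathrm{Lip}_0(M)^*$ be the Lipschitz-free space over $M$, where $\delta(x)(f)=f(x)$. Then $\mathcal{F}(M)$ has Pełczyński's property (V$^*$). Here a Banach space $X$ has property (V$^*$) if every (V$^*$)-set $\Gamma\subset X$ is relatively weakly compact (its weak closure is weakly compact). A set $\Gamma\subset X$ is a (V$^*$)-set if $\lim_{n\to\infty}\sup_{x\in\Gamma}|x_n^*(x)|=0$ for every sequence $(x_n^*)$ in $X^*$ such that $\sum_n|x^{**}(x_n^*)|<\infty$ for all $x^{**}\in X^{**}$. -/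

import Mathlib

open Filter Topology

noncomputable section

namespace LipFree

/-! ### The space of Lipschitz functions vanishing at the base point -/

section Lip0

variable {M : Type*} [MetricSpace M]

/-- The linear space of all Lipschitz functions `f : M → ℝ` with `f o = 0`. -/
def lipSubmodule (o : M) : Submodule ℝ (M → ℝ) where
  carrier := {f | (∃ K : NNReal, LipschitzWith K f) ∧ f o = 0}
  zero_mem' := ⟨⟨0, LipschitzWith.const 0⟩, rfl⟩
  add_mem' := by
    rintro f g ⟨⟨K, hf⟩, hf0⟩ ⟨⟨L, hg⟩, hg0⟩
    exact ⟨⟨K + L, hf.add hg⟩, by simp [hf0, hg0]⟩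
  smul_mem' := by
    rintro c f ⟨⟨K, hf⟩, hf0⟩
    exact ⟨⟨‖c‖₊ * K, (lipschitzWith_smul c).comp hf⟩, by simp [hf0]⟩

/-- `Lip₀(M)`, for the metric space `M` with base point `o`. This is a type of its own (not the
subtype of `M → ℝ`), so that it does not inherit the topology of pointwise convergence. -/
def Lip0 (o : M) : Type _ := ↥(lipSubmodule o)

instance (o : M) : AddCommGroup (Lip0 o) := inferInstanceAs (AddCommGroup ↥(lipSubmodule o))

instance (o : M) : Module ℝ (Lip0 o) := inferInstanceAs (Module ℝ ↥(lipSubmodule o))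

instance (o : M) : CoeFun (Lip0 o) (fun _ => M → ℝ) := ⟨fun f => f.1⟩

/-- The Lipschitz constant of `f`: the supremum of `|f x - f y| / d(x, y)` over all `x`, `y`
(pairs with `x = y` contribute `0 / 0 = 0`, which does not change the supremum). -/
def lipConst (f : M → ℝ) : ℝ := ⨆ p : M × M, |f p.1 - f p.2| / dist p.1 p.2

theorem lipConst_nonneg (f : M → ℝ) : 0 ≤ lipConst f :=
  Real.iSup_nonneg fun _ => by positivity

theorem bddAbove_of_lipschitz {f : M → ℝ} {K : NNReal} (hf : LipschitzWith K f) :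
    BddAbove (Set.range fun p : M × M => |f p.1 - f p.2| / dist p.1 p.2) := by
  refine ⟨K, ?_⟩
  rintro _ ⟨p, rfl⟩
  exact div_le_of_le_mul₀ dist_nonneg K.2 (by simpa [Real.dist_eq] using hf.dist_le_mul p.1 p.2)

theorem lipConst_le {f : M → ℝ} {C : ℝ} (hC : 0 ≤ C)
    (h : ∀ x y, |f x - f y| ≤ C * dist x y) : lipConst f ≤ C :=
  Real.iSup_le (fun p => div_le_of_le_mul₀ dist_nonneg hC (h p.1 p.2)) hC

variable {o : M}

theorem Lip0.abs_sub_le (f : Lip0 o) (x y : M) : |f x - f y| ≤ lipConst f * dist x y := by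
  obtain ⟨⟨K, hK⟩, -⟩ := f.2
  rcases eq_or_ne x y with rfl | hxy
  · simp
  · rw [← div_le_iff₀ (dist_pos.2 hxy)]
    exact le_ciSup (bddAbove_of_lipschitz hK) (x, y)

instance : Norm (Lip0 o) := ⟨fun f => lipConst f⟩

theorem Lip0.core : NormedSpace.Core ℝ (Lip0 o) where
  norm_nonneg f := lipConst_nonneg f
  norm_smul c f := by
    change (⨆ p : M × M, |c * f p.1 - c * f p.2| / dist p.1 p.2) = ‖c‖ * lipConst f
    rw [lipConst, Real.mul_iSup_of_nonneg (norm_nonneg c)]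
    refine iSup_congr fun p => ?_
    rw [← mul_sub, abs_mul, mul_div_assoc, Real.norm_eq_abs]
  norm_triangle f g := by
    refine lipConst_le (add_nonneg (lipConst_nonneg f) (lipConst_nonneg g)) fun x y => ?_
    have h : (f + g) x - (f + g) y = (f x - f y) + (g x - g y) := add_sub_add_comm _ _ _ _
    rw [h, add_mul]
    exact (abs_add_le _ _).trans (add_le_add (f.abs_sub_le x y) (g.abs_sub_le x y))
  norm_eq_zero_iff f := by
    constructor
    · intro h
      refine Subtype.ext (funext fun x => ?_)
      have h1 := f.abs_sub_le x o
      have h2 : f o = 0 := f.2.2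
      have h3 : lipConst f = 0 := h
      rw [h2, h3, zero_mul, sub_zero] at h1
      exact abs_nonpos_iff.1 h1
    · rintro rfl
      refine le_antisymm (lipConst_le le_rfl fun x y => ?_) (lipConst_nonneg _)
      change |(0 : ℝ) - 0| ≤ 0 * dist x y
      simp

instance : NormedAddCommGroup (Lip0 o) := NormedAddCommGroup.ofCore Lip0.core

instance : NormedSpace ℝ (Lip0 o) := NormedSpace.ofCore Lip0.core

/-! ### The Lipschitz-free space -/

/-- The evaluation functional `δ(x) : f ↦ f x` in the dual of `Lip₀(M)`. -/
def delta (o x : M) : StrongDual ℝ (Lip0 o) :=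
  LinearMap.mkContinuous
    { toFun := fun f => f x
      map_add' := fun _ _ => rfl
      map_smul' := fun _ _ => rfl } (dist x o) (by
    intro f
    have h := f.abs_sub_le x o
    have h2 : f o = 0 := f.2.2
    rw [h2, sub_zero, mul_comm] at h
    exact h)

/-- The Lipschitz-free space `F(M)` over the metric space `M` with base point `o`: the closed linear
span of the evaluation functionals in the dual of `Lip₀(M)`, with the dual norm. -/
abbrev FreeSpace (o : M) : Submodule ℝ (StrongDual ℝ (Lip0 o)) :=
  (Submodule.span ℝ (Set.range (delta o))).topologicalClosure

instance : CompleteSpace (FreeSpace o) :=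
  (Submodule.isClosed_topologicalClosure _).completeSpace_coe

end Lip0

/-! ### Property (V*) -/

section VStar

variable {X : Type*} [NormedAddCommGroup X] [NormedSpace ℝ X]

/-- The series `∑ xₙ` is weakly unconditionally Cauchy: `∑ |x*(xₙ)| < ∞` for every functional `x*`
in the dual of `X`. -/
def IsWUC (x : ℕ → X) : Prop :=
  ∀ φ : StrongDual ℝ X, Summable fun n => |φ (x n)|

/-- `Γ` is a (V*)-set with respect to `X`: `sup_{x ∈ Γ} |φₙ(x)| → 0` for every weakly
unconditionally Cauchy series `∑ φₙ` in the dual of `X`. The supremum is taken in `[0, ∞]`. -/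
def IsVStarSet (Γ : Set X) : Prop :=
  ∀ φ : ℕ → StrongDual ℝ X, IsWUC φ → Tendsto (fun n => ⨆ x ∈ Γ, ‖φ n x‖ₑ) atTop (𝓝 0)

/-- `Γ` is relatively weakly compact: its closure in the weak topology is weakly compact. -/
def IsRelWeaklyCompact (Γ : Set X) : Prop :=
  IsCompact (closure (toWeakSpace ℝ X '' Γ))

/-- The Banach space `X` has property (V*): every (V*)-set is relatively weakly compact. -/
def PropertyVStar (X : Type*) [NormedAddCommGroup X] [NormedSpace ℝ X] [CompleteSpace X] : Prop :=
  ∀ Γ : Set X, IsVStarSet Γ → IsRelWeaklyCompact Γ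

end VStar

end LipFree

end

noncomputable section

namespace LipFree

variable {M : Type*} [MetricSpace M] {o : M}

/-! More is true: a (V*)-set `Γ` is totally bounded in norm. By duality it suffices to find, for
each `ε`, a finite `K` such that 1-Lipschitz functions vanishing on `K` are at most `ε` on `Γ`; then
`Γ` lies close to the span of the `δ(x)`, `x ∈ K`.

Lipschitz functions with disjoint supports and bounded norms form a weakly unconditionally Cauchy
series. A gliding hump therefore forces `Γ` to concentrate near a finite set `E`, with distance to
`E` measured relative to the distance to `o` (`IsVStarSet.exists_finset_concentrated`). Doing this
for ever narrower neighbourhoods, and truncating successively with summable errors, pushes a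
function into the intersection of these neighbourhoods. By completeness and discreteness, finitely
many of them already meet in a finite set (`exists_finite_inter_relNhd`); that set is `K`. -/

theorem Lip0.apply_base (f : Lip0 o) : f o = 0 := f.2.2

theorem Lip0.abs_sub_le_norm (f : Lip0 o) (x y : M) : |f x - f y| ≤ ‖f‖ * dist x y :=
  f.abs_sub_le x y

theorem Lip0.abs_le_norm (f : Lip0 o) (x : M) : |f x| ≤ ‖f‖ * dist x o := by
  simpa [f.apply_base] using f.abs_sub_le_norm x o

theorem Lip0.sub_apply (f g : Lip0 o) (x : M) : (f - g) x = f x - g x := rfl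

theorem Lip0.smul_apply (c : ℝ) (f : Lip0 o) (x : M) : (c • f) x = c * f x := rfl

theorem Lip0.sum_apply {ι : Type*} (s : Finset ι) (g : ι → Lip0 o) (x : M) :
    (∑ i ∈ s, g i) x = ∑ i ∈ s, g i x := by
  classical
  induction s using Finset.induction_on with
  | empty => rfl
  | insert a s ha ih =>
    rw [Finset.sum_insert ha, Finset.sum_insert ha, ← ih]
    rfl

theorem Lip0.norm_le {f : Lip0 o} {C : ℝ} (hC : 0 ≤ C)
    (h : ∀ x y, |f x - f y| ≤ C * dist x y) : ‖f‖ ≤ C :=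
  lipConst_le hC h

@[ext]
theorem Lip0.ext {f g : Lip0 o} (h : ∀ x, f x = g x) : f = g :=
  Subtype.ext (funext h)

/-- A function satisfying a Lipschitz estimate and vanishing at the base point, as an element of
`Lip0 o`. -/
def Lip0.mk (f : M → ℝ) (C : ℝ) (h : ∀ x y, |f x - f y| ≤ C * dist x y) (h0 : f o = 0) :
    Lip0 o :=
  ⟨f, ⟨C.toNNReal, LipschitzWith.of_dist_le_mul fun x y => by
    rw [Real.dist_eq]
    exact (h x y).trans (mul_le_mul_of_nonneg_right (Real.le_coe_toNNReal C) dist_nonneg)⟩, h0⟩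

theorem Lip0.mk_apply (f : M → ℝ) (C : ℝ) (h : ∀ x y, |f x - f y| ≤ C * dist x y) (h0 : f o = 0)
    (x : M) : Lip0.mk (o := o) f C h h0 x = f x := rfl

/-! ### Truncation and disjoint supports -/

/-- Truncation of a Lipschitz function between `-u` and `u`. -/
theorem Lip0.exists_truncation (f : Lip0 o) {u : M → ℝ} (hu0 : ∀ x, 0 ≤ u x) {C : ℝ}
    (hu : ∀ x y, |u x - u y| ≤ C * dist x y) (hf : ‖f‖ ≤ C) :
    ∃ g : Lip0 o, ‖g‖ ≤ C ∧ (∀ x, |g x| ≤ |f x|) ∧ (∀ x, |f x| ≤ u x → g x = f x) ∧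
      ∀ x, u x = 0 → g x = 0 := by
  have hC : 0 ≤ C := (norm_nonneg f).trans hf
  have habs : ∀ x, |max (-u x) (min (u x) (f x))| ≤ |f x| := by
    intro x
    have := hu0 x
    rcases abs_cases (f x) with h | h <;> rw [abs_le] <;> constructor <;> grind
  have hlip : ∀ x y, |max (-u x) (min (u x) (f x)) - max (-u y) (min (u y) (f y))|
      ≤ C * dist x y := by
    intro x y
    have h1 := hu x y
    have h2 := (f.abs_sub_le_norm x y).trans (mul_le_mul_of_nonneg_right hf dist_nonneg)
    refine (abs_max_sub_max_le_max _ _ _ _).trans (max_le ?_ ?_)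
    · rwa [neg_sub_neg, abs_sub_comm]
    · exact (abs_min_sub_min_le_max _ _ _ _).trans (max_le h1 h2)
  refine ⟨Lip0.mk _ C hlip ?_, Lip0.norm_le hC hlip, habs, fun x hx => ?_, fun x hx => ?_⟩
  · simpa [f.apply_base] using habs o
  · rw [Lip0.mk_apply]
    have := abs_le.1 hx
    rw [min_eq_right this.2, max_eq_right this.1]
  · rw [Lip0.mk_apply, hx]
    simp

/-- The sum of functions with pairwise disjoint supports and Lipschitz constant at most `L` has
Lipschitz constant at most `2 * L`. -/
theorem Lip0.norm_sum_le_of_disjoint {ι : Type*} (g : ι → Lip0 o) {L : ℝ} (hL : ∀ i, ‖g i‖ ≤ L)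
    (hd : ∀ i j x, g i x ≠ 0 → g j x ≠ 0 → i = j) (s : Finset ι) (c : ι → ℝ)
    (hc : ∀ i, |c i| ≤ 1) (hL0 : 0 ≤ L) : ‖∑ i ∈ s, c i • g i‖ ≤ 2 * L := by
  classical
  refine Lip0.norm_le (by positivity) fun x y => ?_
  simp only [Lip0.sum_apply, Lip0.smul_apply]
  rw [← Finset.sum_sub_distrib]
  have key : ∀ i, |c i * g i x - c i * g i y| ≤ L * dist x y := fun i => by
    rw [← mul_sub, abs_mul]
    calc |c i| * |g i x - g i y| ≤ 1 * |g i x - g i y| :=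
          mul_le_mul_of_nonneg_right (hc i) (abs_nonneg _)
      _ ≤ L * dist x y := by
          rw [one_mul]
          exact (Lip0.abs_sub_le_norm _ _ _).trans
            (mul_le_mul_of_nonneg_right (hL i) dist_nonneg)
  -- At most one summand is alive at `x` and one at `y`, whence the factor 2.
  have hcard : (s.filter fun i => g i x ≠ 0 ∨ g i y ≠ 0).card ≤ 2 := by
    have hx : (s.filter fun i => g i x ≠ 0).card ≤ 1 :=
      Finset.card_le_one.2 fun a ha b hb =>
        hd a b x (Finset.mem_filter.1 ha).2 (Finset.mem_filter.1 hb).2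
    have hy : (s.filter fun i => g i y ≠ 0).card ≤ 1 :=
      Finset.card_le_one.2 fun a ha b hb =>
        hd a b y (Finset.mem_filter.1 ha).2 (Finset.mem_filter.1 hb).2
    rw [Finset.filter_or]
    exact (Finset.card_union_le _ _).trans (by omega)
  rw [← Finset.sum_filter_of_ne (p := fun i => g i x ≠ 0 ∨ g i y ≠ 0)]
  · refine (Finset.abs_sum_le_sum_abs _ _).trans
      ((Finset.sum_le_card_nsmul _ _ _ fun i _ => key i).trans ?_)
    rw [nsmul_eq_mul, mul_assoc]
    exact mul_le_mul_of_nonneg_right (by exact_mod_cast hcard) (by positivity)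
  · intro i _ h
    by_contra! h2
    exact h (by simp [h2.1, h2.2])

/-- A series all of whose finite sub-sums with coefficients in `[-1, 1]` are uniformly bounded is
weakly unconditionally Cauchy. -/
theorem isWUC_of_norm_sum_le {X : Type*} [NormedAddCommGroup X] [NormedSpace ℝ X] {x : ℕ → X}
    {C : ℝ} (h : ∀ (s : Finset ℕ) (c : ℕ → ℝ), (∀ i, |c i| ≤ 1) → ‖∑ i ∈ s, c i • x i‖ ≤ C) :
    IsWUC x := by
  intro φ
  refine summable_of_sum_le (c := ‖φ‖ * C) (fun _ => abs_nonneg _) fun s => ?_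
  have h1 : ∑ i ∈ s, |φ (x i)| = φ (∑ i ∈ s, (SignType.sign (φ (x i)) : ℝ) • x i) := by
    rw [map_sum]
    refine Finset.sum_congr rfl fun i _ => ?_
    rw [map_smul, smul_eq_mul, sign_mul_self]
  rw [h1]
  refine (le_abs_self _).trans ((φ.le_opNorm _).trans
    (mul_le_mul_of_nonneg_left (h s _ fun i => ?_) (norm_nonneg _)))
  rcases lt_trichotomy (φ (x i)) 0 with h | h | h <;> simp [h]

/-! ### Duality -/

/-- The dual of a normed space, with the module structure and the topology coming from the norm,
also where `X` is a submodule, for which `StrongDual ℝ X` would elaborate to the subspace ones. -/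
abbrev NormedDual (X : Type*) [NormedAddCommGroup X] [NormedSpace ℝ X] : Type _ := StrongDual ℝ X

theorem abs_apply_sub_le {X : Type*} [NormedAddCommGroup X] [NormedSpace ℝ X] (Φ : NormedDual X)
    (a b : X) : |Φ a - Φ b| ≤ ‖Φ‖ * ‖a - b‖ := by
  rw [← map_sub]
  exact Φ.le_opNorm _

theorem eq_of_forall_exists_approx {X : Type*} [NormedAddCommGroup X] [NormedSpace ℝ X]
    {Φ Ψ : NormedDual X} {a : X} (h : ∀ η > 0, ∃ b, Φ b = Ψ b ∧ ‖a - b‖ < η) : Φ a = Ψ a := by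
  have hcl : IsClosed {b | Φ b = Ψ b} := isClosed_eq Φ.continuous Ψ.continuous
  refine hcl.closure_subset (Metric.mem_closure_iff.2 fun η hη => ?_)
  obtain ⟨b, hb, hlt⟩ := h η hη
  exact ⟨b, hb, by rwa [dist_eq_norm]⟩

/-- The functional on the free space given by a Lipschitz function. -/
def evalFree (f : Lip0 o) : NormedDual (FreeSpace o) :=
  (NormedSpace.inclusionInDoubleDual ℝ (Lip0 o) f).comp (FreeSpace o).subtypeL

theorem evalFree_apply (f : Lip0 o) (γ : FreeSpace o) : evalFree f γ = γ.1 f := rfl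

theorem norm_evalFree_le (f : Lip0 o) : ‖evalFree f‖ ≤ ‖f‖ :=
  ContinuousLinearMap.opNorm_le_bound _ (norm_nonneg _) fun γ => by
    rw [evalFree_apply, mul_comm]
    exact γ.1.le_opNorm f

theorem evalFree_sum_smul (s : Finset ℕ) (c : ℕ → ℝ) (g : ℕ → Lip0 o) :
    evalFree (∑ i ∈ s, c i • g i) = ∑ i ∈ s, c i • evalFree (g i) := by
  ext γ
  simp [evalFree_apply]

/-- The evaluation functional at `x` as an element of the free space. -/
def deltaFree (o x : M) : FreeSpace o :=
  ⟨delta o x, Submodule.le_topologicalClosure _ (Submodule.subset_span ⟨x, rfl⟩)⟩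

theorem norm_deltaFree_sub_le (x y : M) : ‖deltaFree o x - deltaFree o y‖ ≤ dist x y := by
  refine ContinuousLinearMap.opNorm_le_bound _ dist_nonneg fun f => ?_
  rw [mul_comm]
  exact f.abs_sub_le_norm x y

/-- Elements of the free space are limits of finitely supported ones. -/
theorem exists_finset_approx (γ : FreeSpace o) {η : ℝ} (hη : 0 < η) :
    ∃ F : Finset M, ∃ μ ∈ Submodule.span ℝ (deltaFree o '' F), ‖γ - μ‖ < η := by
  classical
  obtain ⟨m, hm, hd⟩ := Metric.mem_closure_iff.1 γ.2 η hη
  obtain ⟨T, hT, hmT⟩ := Submodule.mem_span_finite_of_mem_span hm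
  obtain ⟨F, rfl⟩ : ∃ F : Finset M, F.image (delta o) = T := by
    rw [← Set.image_univ] at hT
    obtain ⟨F, -, hF⟩ := Finset.subset_set_image_iff.1 hT
    exact ⟨F, hF⟩
  have hle : (Submodule.span ℝ (delta o '' F)) ≤
      (Submodule.span ℝ (deltaFree o '' F)).map (FreeSpace o).subtype := by
    rw [Submodule.map_span, Set.image_image]
    exact le_rfl
  rw [Finset.coe_image] at hmT
  obtain ⟨μ, hμ, rfl⟩ := hle hmT
  refine ⟨F, μ, hμ, ?_⟩
  rw [dist_eq_norm] at hd
  exact hd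

theorem eq_of_mem_span_deltaFree {Φ Ψ : NormedDual (FreeSpace o)} {F : Set M}
    (h : ∀ x ∈ F, Φ (deltaFree o x) = Ψ (deltaFree o x)) {μ : FreeSpace o}
    (hμ : μ ∈ Submodule.span ℝ (deltaFree o '' F)) : Φ μ = Ψ μ := by
  refine LinearMap.eqOn_span (f := Φ.toLinearMap) (g := Ψ.toLinearMap) ?_ hμ
  rintro _ ⟨x, hx, rfl⟩
  exact h x hx

theorem deltaFree_base : deltaFree o o = 0 :=
  Subtype.ext (ContinuousLinearMap.ext fun f => f.apply_base)

theorem abs_apply_deltaFree_sub_le (Φ : NormedDual (FreeSpace o)) (x y : M) :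
    |Φ (deltaFree o x) - Φ (deltaFree o y)| ≤ ‖Φ‖ * dist x y :=
  (abs_apply_sub_le Φ _ _).trans
    (mul_le_mul_of_nonneg_left (norm_deltaFree_sub_le x y) (norm_nonneg Φ))

theorem apply_deltaFree_base (Φ : NormedDual (FreeSpace o)) : Φ (deltaFree o o) = 0 := by
  rw [deltaFree_base]
  exact map_zero Φ

/-- The Lipschitz function `x ↦ Φ (δ x)` given by a functional `Φ` on the free space. -/
def toLip0 (Φ : NormedDual (FreeSpace o)) : Lip0 o :=
  Lip0.mk (fun x => Φ (deltaFree o x)) ‖Φ‖ (abs_apply_deltaFree_sub_le Φ) (apply_deltaFree_base Φ)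

theorem norm_toLip0_le (Φ : NormedDual (FreeSpace o)) : ‖toLip0 Φ‖ ≤ ‖Φ‖ :=
  Lip0.norm_le (norm_nonneg Φ) (abs_apply_deltaFree_sub_le Φ)

theorem evalFree_toLip0_deltaFree (Φ : NormedDual (FreeSpace o)) (x : M) :
    Φ (deltaFree o x) = evalFree (toLip0 Φ) (deltaFree o x) := rfl

/-- Every functional on the free space is given by a Lipschitz function. -/
theorem evalFree_toLip0 (Φ : NormedDual (FreeSpace o)) : Φ = evalFree (toLip0 Φ) := by
  refine ContinuousLinearMap.ext fun γ => eq_of_forall_exists_approx fun η hη => ?_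
  obtain ⟨F, μ, hμ, hlt⟩ := exists_finset_approx γ hη
  exact ⟨μ, eq_of_mem_span_deltaFree (fun x _ => evalFree_toLip0_deltaFree Φ x) hμ, hlt⟩

theorem isWUC_evalFree (g : ℕ → Lip0 o) {L : ℝ} (hL : ∀ i, ‖g i‖ ≤ L)
    (hd : ∀ i j x, g i x ≠ 0 → g j x ≠ 0 → i = j) : IsWUC fun n => evalFree (g n) :=
  isWUC_of_norm_sum_le (C := 2 * L) fun s c hc => by
    rw [← evalFree_sum_smul]
    exact (norm_evalFree_le _).trans
      (Lip0.norm_sum_le_of_disjoint g hL hd s c hc ((norm_nonneg _).trans (hL 0)))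

/-! ### Compactness in normed spaces -/

section Normed

variable {X : Type*} [NormedAddCommGroup X] [NormedSpace ℝ X]

theorem IsVStarSet.tendsto_apply {Γ : Set X} (hΓ : IsVStarSet Γ) {φ : ℕ → NormedDual X}
    (hφ : IsWUC φ) {γ : ℕ → X} (hγ : ∀ n, γ n ∈ Γ) :
    Tendsto (fun n => |φ n (γ n)|) atTop (𝓝 0) := by
  have h : Tendsto (fun n => ‖φ n (γ n)‖ₑ) atTop (𝓝 0) :=
    tendsto_of_tendsto_of_tendsto_of_le_of_le tendsto_const_nhds (hΓ φ hφ) (fun _ => zero_le)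
      fun n => le_iSup₂ (f := fun x (_ : x ∈ Γ) => ‖φ n x‖ₑ) (γ n) (hγ n)
  have h2 := (ENNReal.tendsto_toReal ENNReal.zero_ne_top).comp h
  simpa [Function.comp_def] using h2

/-- Otherwise pick `γ n ∈ Γ` of norm above `2 ^ n`: norming functionals scaled by `2 ^ (-n)` form an
absolutely convergent series whose values at `γ n` exceed 1. -/
theorem IsVStarSet.exists_norm_le {Γ : Set X} (hΓ : IsVStarSet Γ) :
    ∃ C, ∀ γ ∈ Γ, ‖γ‖ ≤ C := by
  by_contra! h
  choose γ hγ hlt using fun n : ℕ => h (2 ^ n)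
  choose ψ hψ hψγ using fun n : ℕ => exists_dual_vector'' ℝ (γ n)
  have hW : IsWUC fun n => ((1 / 2 : ℝ) ^ n) • ψ n := by
    intro Φ
    refine Summable.of_nonneg_of_le (fun _ => abs_nonneg _) (fun n => ?_)
      (summable_geometric_two.mul_left ‖Φ‖)
    refine (Φ.le_opNorm _).trans (mul_le_mul_of_nonneg_left ?_ (norm_nonneg _))
    rw [norm_smul, Real.norm_of_nonneg (by positivity)]
    exact mul_le_of_le_one_right (by positivity) (hψ n)
  have ht := hΓ.tendsto_apply hW hγ
  obtain ⟨n, hn⟩ := (ht.eventually_lt_const one_pos).exists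
  have h1 : ((1 / 2 : ℝ) ^ n • ψ n) (γ n) = (1 / 2) ^ n * ‖γ n‖ := by
    rw [smul_apply, hψγ n]
    rfl
  rw [h1, abs_of_nonneg (by positivity)] at hn
  have h2 : (1 / 2 : ℝ) ^ n * 2 ^ n = 1 := by rw [← mul_pow]; norm_num
  nlinarith [hlt n, pow_pos (show (0 : ℝ) < 1 / 2 by norm_num) n]

/-- Distance estimate to a subspace by duality. -/
theorem exists_norm_sub_lt_of_dual (S : Submodule ℝ X) {a : X} {ε : ℝ} (hε : 0 < ε)
    (h : ∀ Φ : NormedDual X, ‖Φ‖ ≤ 1 → (∀ s ∈ S, Φ s = 0) → |Φ a| ≤ ε) :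
    ∃ s ∈ S, ‖a - s‖ < 2 * ε := by
  -- A functional norming the class of `a` in the quotient by `S`, pulled back, vanishes on `S`. The
  -- factor 2 gives room because the quotient norm need not be attained.
  obtain ⟨g, hg, hga⟩ := exists_dual_vector'' ℝ (S.mkQ a)
  have hΦ : ‖g.comp S.mkQL‖ ≤ 1 := by
    refine ContinuousLinearMap.opNorm_le_bound _ zero_le_one fun x => ?_
    calc ‖g (S.mkQ x)‖ ≤ 1 * ‖S.mkQ x‖ := g.le_of_opNorm_le hg _
      _ ≤ 1 * ‖x‖ := mul_le_mul_of_nonneg_left (Submodule.Quotient.norm_mk_le _ _) zero_le_one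
  have h1 := h (g.comp S.mkQL) hΦ fun s hs => by
    have : S.mkQ s = 0 := by simpa using hs
    change g (S.mkQ s) = 0
    rw [this, map_zero]
  have h2 : ‖S.mkQ a‖ < 2 * ε := by
    have h3 : |g (S.mkQ a)| ≤ ε := h1
    rw [hga] at h3
    have h4 := le_abs_self ((‖S.mkQ a‖ : ℝ))
    have h5 : |(‖S.mkQ a‖ : ℝ)| ≤ ε := h3
    linarith
  obtain ⟨m, hm, hlt⟩ := Submodule.Quotient.norm_mk_lt (S.mkQ a) (sub_pos.2 h2)
  rw [add_sub_cancel] at hlt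
  refine ⟨a - m, (Submodule.Quotient.eq S).1 hm.symm, by simpa using hlt⟩

theorem totallyBounded_of_finiteDimensional_approx {Γ : Set X} {C : ℝ}
    (hC : ∀ γ ∈ Γ, ‖γ‖ ≤ C)
    (h : ∀ ε > 0, ∃ S : Submodule ℝ X, FiniteDimensional ℝ S ∧ ∀ γ ∈ Γ, ∃ s ∈ S, ‖γ - s‖ < ε) :
    TotallyBounded Γ := by
  refine Metric.totallyBounded_iff.2 fun ε hε => ?_
  obtain ⟨S, hS, hΓ⟩ := h (ε / 2) (half_pos hε)
  have : ProperSpace S := FiniteDimensional.proper ℝ S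
  have hK : TotallyBounded (Subtype.val '' Metric.closedBall (0 : S) (C + ε / 2)) :=
    ((isCompact_closedBall _ _).image continuous_subtype_val).totallyBounded
  obtain ⟨t, ht, hcov⟩ := Metric.totallyBounded_iff.1 hK (ε / 2) (half_pos hε)
  refine ⟨t, ht, fun γ hγ => ?_⟩
  obtain ⟨s, hs, hlt⟩ := hΓ γ hγ
  have hs' : ‖s‖ ≤ C + ε / 2 := by
    have := norm_sub_norm_le s γ
    rw [norm_sub_rev] at this
    linarith [hC γ hγ]
  obtain ⟨y, hy, hd⟩ := Set.mem_iUnion₂.1 (hcov ⟨⟨s, hs⟩, by simpa using hs', rfl⟩)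
  refine Set.mem_iUnion₂.2 ⟨y, hy, ?_⟩
  rw [Metric.mem_ball] at hd ⊢
  have := dist_triangle γ s y
  rw [dist_eq_norm γ s] at this
  linarith

theorem isRelWeaklyCompact_of_totallyBounded [CompleteSpace X] {Γ : Set X}
    (h : TotallyBounded Γ) : IsRelWeaklyCompact Γ := by
  have hc : IsCompact (closure Γ) := h.closure.isCompact_of_isClosed isClosed_closure
  have hw : IsCompact (toWeakSpace ℝ X '' closure Γ) :=
    hc.image (toWeakSpaceCLM ℝ X).continuous
  exact hw.of_isClosed_subset isClosed_closure
    (closure_minimal (Set.image_mono subset_closure) hw.isClosed)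

end Normed

/-! ### Concentration of (V*)-sets -/

/-- The points whose distance to `E` is at most `a / k` times their distance to `o`. -/
def relNhd (o : M) (E : Set M) (a k : ℝ) : Set M :=
  {x | k * Metric.infDist x E ≤ a * dist x o}

theorem relNhd_mono {E F : Set M} (hEF : E ⊆ F) (hE : E.Nonempty) {a k : ℝ} (hk : 0 ≤ k) :
    relNhd o E a k ⊆ relNhd o F a k := fun _ hx =>
  (mul_le_mul_of_nonneg_left (Metric.infDist_le_infDist_of_subset hEF hE) hk).trans hx

/-- Truncation of a Lipschitz function to `relNhd o E (a + 1) k`, leaving it unchanged on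
`relNhd o E a k`. -/
theorem Lip0.exists_truncation_relNhd (f : Lip0 o) (E : Set M) {a k C : ℝ} (ha : 0 ≤ a)
    (hk : 0 ≤ k) (hC : a + 1 + k ≤ C) (hf : ‖f‖ ≤ C) (hf' : ∀ x, |f x| ≤ dist x o) :
    ∃ g : Lip0 o, ‖g‖ ≤ C ∧ (∀ x, |g x| ≤ |f x|) ∧ (∀ x ∈ relNhd o E a k, g x = f x) ∧
      ∀ x ∉ relNhd o E (a + 1) k, g x = 0 := by
  -- On `relNhd o E a k` this is at least `dist x o ≥ |f x|`, so `f` survives there; off `relNhd o E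
  -- (a + 1) k` it is 0.
  set u : M → ℝ := fun x => max ((a + 1) * dist x o - k * Metric.infDist x E) 0 with hu
  have hlip : ∀ x y, |u x - u y| ≤ C * dist x y := by
    intro x y
    refine (abs_max_sub_max_le_abs _ _ _).trans ?_
    have h1 : |dist x o - dist y o| ≤ dist x y := abs_dist_sub_le x y o
    have h2 : |Metric.infDist x E - Metric.infDist y E| ≤ dist x y := by
      simpa [Real.dist_eq] using (Metric.lipschitz_infDist_pt E).dist_le_mul x y
    calc _ = |(a + 1) * (dist x o - dist y o) - k * (Metric.infDist x E - Metric.infDist y E)| := by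
          congr 1; ring
      _ ≤ (a + 1) * dist x y + k * dist x y := by
          refine (abs_sub _ _).trans ?_
          rw [abs_mul, abs_mul, abs_of_nonneg (by positivity : 0 ≤ a + 1), abs_of_nonneg hk]
          gcongr
      _ ≤ C * dist x y := by
          rw [← add_mul]
          exact mul_le_mul_of_nonneg_right hC dist_nonneg
  obtain ⟨g, hg, hgf, heq, h0⟩ := f.exists_truncation (fun x => le_max_right _ _) hlip hf
  refine ⟨g, hg, hgf, fun x hx => heq x ?_, fun x hx => h0 x ?_⟩
  · have : k * Metric.infDist x E ≤ a * dist x o := hx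
    exact le_max_of_le_left (by linarith [hf' x])
  · have : ¬ k * Metric.infDist x E ≤ (a + 1) * dist x o := hx
    exact max_eq_right (by linarith)

theorem abs_apply_sub_le_mul {X : Type*} [NormedAddCommGroup X] [NormedSpace ℝ X]
    {Φ : NormedDual X} {a b : X} {C η : ℝ} (hΦ : ‖Φ‖ ≤ C) (h : ‖a - b‖ < η) :
    |Φ a - Φ b| ≤ C * η :=
  (abs_apply_sub_le Φ a b).trans
    (mul_le_mul hΦ h.le (norm_nonneg _) ((norm_nonneg _).trans hΦ))

theorem evalFree_deltaFree (f : Lip0 o) (x : M) : evalFree f (deltaFree o x) = f x := rfl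

theorem evalFree_eq_of_eqOn {f g : Lip0 o} {F : Set M} (h : ∀ x ∈ F, f x = g x)
    {μ : FreeSpace o} (hμ : μ ∈ Submodule.span ℝ (deltaFree o '' F)) :
    evalFree f μ = evalFree g μ :=
  eq_of_mem_span_deltaFree
    (fun x hx => by rw [evalFree_deltaFree, evalFree_deltaFree, h x hx]) hμ

theorem evalFree_smul (c : ℝ) (f : Lip0 o) (γ : FreeSpace o) :
    evalFree (c • f) γ = c * evalFree f γ :=
  γ.1.map_smul c f

theorem evalFree_sub (f g : Lip0 o) (γ : FreeSpace o) :
    evalFree (f - g) γ = evalFree f γ - evalFree g γ :=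
  γ.1.map_sub f g

/-- If `γ` does not concentrate on `relNhd o E 1 k`, this is witnessed by a Lipschitz function
vanishing off some larger set of the same kind. -/
theorem exists_truncated_witness {γ : FreeSpace o} {E : Finset M} {f : Lip0 o} {k ε : ℝ}
    (hk : 0 < k) (hε : 0 < ε) (hf1 : ‖f‖ ≤ 1) (hf0 : ∀ x ∈ relNhd o (E : Set M) 1 k, f x = 0)
    (hf : ε < |evalFree f γ|) :
    ∃ (E' : Finset M) (g : Lip0 o), E ⊆ E' ∧ ‖g‖ ≤ 1 + k ∧ ε / 2 ≤ |evalFree g γ| ∧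
      (∀ x ∈ relNhd o (E : Set M) 1 k, g x = 0) ∧
      ∀ x ∉ relNhd o (E' : Set M) 1 k, g x = 0 := by
  classical
  -- Replacing `γ` by `μ` costs `η` for `f` and `(1 + k) * η` for `g`, in total `ε / 2`.
  have hη : 0 < ε / (2 * (2 + k)) := by positivity
  obtain ⟨F, μ, hμ, hlt⟩ := exists_finset_approx γ hη
  have hfd : ∀ x, |f x| ≤ dist x o := fun x =>
    (f.abs_le_norm x).trans (mul_le_of_le_one_left dist_nonneg hf1)
  -- With `a = 0` the truncation keeps `f` at the points of `F`, which is all that `μ` sees.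
  obtain ⟨g, hg, hgf, heq, h0⟩ := f.exists_truncation_relNhd ((E ∪ F : Finset M) : Set M)
    (a := 0) (k := k) (C := 1 + k) le_rfl hk.le (by linarith) (by linarith) hfd
  rw [zero_add] at h0
  refine ⟨E ∪ F, g, Finset.subset_union_left, hg, ?_, fun x hx => ?_, h0⟩
  · have hfg : evalFree f μ = evalFree g μ := by
      refine evalFree_eq_of_eqOn (fun x hx => (heq x ?_).symm) hμ
      have hx' : x ∈ ((E ∪ F : Finset M) : Set M) := by
        rw [Finset.coe_union]
        exact Or.inr hx
      change k * _ ≤ 0 * _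
      rw [Metric.infDist_zero_of_mem hx', mul_zero, zero_mul]
    have h1 := abs_apply_sub_le_mul ((norm_evalFree_le f).trans hf1) hlt
    have h2 := abs_apply_sub_le_mul ((norm_evalFree_le g).trans hg) hlt
    have h3 : 1 * (ε / (2 * (2 + k))) + (1 + k) * (ε / (2 * (2 + k))) = ε / 2 := by
      field_simp
      ring
    rw [hfg] at h1
    have h4 := abs_sub_abs_le_abs_sub (evalFree f γ) (evalFree g γ)
    have h5 := abs_sub_le (evalFree f γ) (evalFree g μ) (evalFree g γ)
    rw [abs_sub_comm (evalFree g μ)] at h5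
    linarith
  · have := hgf x
    rw [hf0 x hx, abs_zero] at this
    exact abs_nonpos_iff.1 this

/-- A (V*)-set in the free space concentrates, up to `ε`, on the set `relNhd o E 1 k` for a finite
set `E`. -/
theorem IsVStarSet.exists_finset_concentrated {Γ : Set (FreeSpace o)} (hΓ : IsVStarSet Γ)
    {k ε : ℝ} (hk : 0 < k) (hε : 0 < ε) :
    ∃ E : Finset M, o ∈ E ∧ ∀ γ ∈ Γ, ∀ f : Lip0 o,
      (∀ x ∈ relNhd o (E : Set M) 1 k, f x = 0) → |evalFree f γ| ≤ ε * ‖f‖ := by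
  by_contra! h
  have step : ∀ E : {E : Finset M // o ∈ E}, ∃ (E' : {E : Finset M // o ∈ E}) (γ : FreeSpace o)
      (g : Lip0 o), E.1 ⊆ E'.1 ∧ γ ∈ Γ ∧ ‖g‖ ≤ 1 + k ∧ ε / 2 ≤ |evalFree g γ| ∧
      (∀ x ∈ relNhd o (E.1 : Set M) 1 k, g x = 0) ∧
      ∀ x ∉ relNhd o (E'.1 : Set M) 1 k, g x = 0 := by
    rintro ⟨E, hE⟩
    obtain ⟨γ, hγ, f, hf0, hf⟩ := h E hE
    have hpos : 0 < ‖f‖ := by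
      refine (norm_nonneg f).lt_of_ne fun h0 => ?_
      have h1 := (evalFree f).le_opNorm γ
      have h2 := norm_evalFree_le f
      rw [← h0] at h2 hf
      have h3 := mul_le_mul_of_nonneg_right h2 (norm_nonneg γ)
      rw [Real.norm_eq_abs] at h1
      linarith
    obtain ⟨E', g, hEE', hg⟩ := exists_truncated_witness (f := ‖f‖⁻¹ • f) (γ := γ) hk hε
      (by rw [norm_smul, norm_inv, norm_norm, inv_mul_cancel₀ hpos.ne'])
      (fun x hx => by rw [Lip0.smul_apply, hf0 x hx, mul_zero])
      (by rwa [evalFree_smul, abs_mul, abs_inv, abs_norm, ← div_eq_inv_mul, lt_div_iff₀ hpos])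
    exact ⟨⟨E', hEE' hE⟩, γ, g, hEE', hγ, hg⟩
  choose next γ g hsub hγ hg hbig hz hoff using step
  let E : ℕ → {E : Finset M // o ∈ E} := fun n => next^[n] ⟨{o}, Finset.mem_singleton_self o⟩
  have hE : ∀ n, E (n + 1) = next (E n) := fun n => Function.iterate_succ_apply' _ _ _
  have hmono : Monotone fun n => (E n).1 := monotone_nat_of_le_succ fun n => by
    rw [hE]
    exact hsub _
  -- The support of the `i`-th hump lies in the neighbourhood of `E (i + 1)`, hence in that of `E
  -- j`, where the `j`-th hump vanishes.
  have hlt : ∀ i j x, i < j → g (E i) x ≠ 0 → g (E j) x ≠ 0 → False := by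
    intro i j x hij hi hj
    refine hj (hz _ x ?_)
    have h1 : x ∈ relNhd o ((E (i + 1)).1 : Set M) 1 k := by
      by_contra hx
      rw [hE] at hx
      exact hi (hoff _ x hx)
    exact relNhd_mono (Finset.coe_subset.2 (hmono (Nat.succ_le_of_lt hij)))
      ⟨o, (E (i + 1)).2⟩ hk.le h1
  have hW : IsWUC fun n => evalFree (g (E n)) := by
    refine isWUC_evalFree _ (fun n => hg (E n)) fun i j x hi hj => ?_
    rcases lt_trichotomy i j with hij | hij | hij
    · exact (hlt i j x hij hi hj).elim
    · exact hij
    · exact (hlt j i x hij hj hi).elim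
  have ht := hΓ.tendsto_apply hW fun n => hγ (E n)
  obtain ⟨n, hn⟩ := (ht.eventually_lt_const (half_pos hε)).exists
  exact absurd (hbig (E n)) (not_le.2 hn)

/-! ### Reduction to finite sets and norm compactness -/

/-- In a complete discrete space, finitely many of the sets `relNhd o (E n) 2 (n + 4)` already have
a finite intersection. -/
theorem exists_finite_inter_relNhd [CompleteSpace M] [DiscreteTopology M] (E : ℕ → Finset M)
    (hE : ∀ n, o ∈ E n) :
    ∃ N : ℕ, {x | ∀ n < N, x ∈ relNhd o (E n : Set M) 2 (n + 4)}.Finite := by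
  by_contra! h
  -- If all finite intersections are infinite, one can choose distinct points lying in more and more
  -- of the sets.
  have hstep : ∀ s : Finset (ℕ × M),
      (∀ p ∈ s, ∀ n < p.1, p.2 ∈ relNhd o (E n : Set M) 2 (n + 4)) →
      ∃ q : ℕ × M, (∀ n < q.1, q.2 ∈ relNhd o (E n : Set M) 2 (n + 4)) ∧
        ∀ p ∈ s, p.1 < q.1 ∧ p.2 ≠ q.2 := by
    classical
    intro s _
    obtain ⟨x, hx, hxs⟩ := (h (s.sup Prod.fst + 1)).exists_notMem_finset (s.image Prod.snd)
    refine ⟨(s.sup Prod.fst + 1, x), hx, fun p hp => ⟨?_, fun he => hxs ?_⟩⟩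
    · exact Nat.lt_succ_of_le (Finset.le_sup (f := Prod.fst) hp)
    · exact Finset.mem_image.2 ⟨p, hp, he⟩
  obtain ⟨q, hq, hlt⟩ := exists_seq_of_forall_finset_exists _ _ hstep
  have hmono : StrictMono fun n => (q n).1 := fun m n hmn => (hlt m n hmn).1
  have hinj : Function.Injective fun n => (q n).2 := fun m n hmn => by
    rcases lt_trichotomy m n with h | h | h
    · exact ((hlt m n h).2 hmn).elim
    · exact h
    · exact ((hlt n m h).2 hmn.symm).elim
  have hmem : ∀ n m, n < m → (q m).2 ∈ relNhd o (E n : Set M) 2 (n + 4) := fun n m hnm =>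
    hq m n (hnm.trans_le (hmono.le_apply))
  have hne : ∀ n, (E n : Set M).Nonempty := fun n => ⟨o, hE n⟩
  have hproj : ∀ n x, ∃ e ∈ E n, Metric.infDist x (E n : Set M) = dist x e := fun n x =>
    (E n).finite_toSet.isCompact.exists_infDist_eq_dist (hne n) x
  obtain ⟨R, hR⟩ : ∃ R, ∀ e ∈ E 0, dist e o ≤ R := by
    obtain ⟨R, hR⟩ := (E 0).finite_toSet.isBounded.subset_closedBall o
    exact ⟨R, fun e he => hR he⟩
  -- For `n = 0` the ratio is `2 / 4`: the distance to `E 0` is at most half the distance to `o`,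
  -- which bounds the latter.
  have hbd : ∀ m, 0 < m → dist (q m).2 o ≤ 2 * R := by
    intro m hm
    have h1 : ((0 : ℕ) + 4 : ℝ) * _ ≤ 2 * _ := hmem 0 m hm
    obtain ⟨e, he, hd⟩ := hproj 0 (q m).2
    rw [hd] at h1
    have := dist_triangle (q m).2 e o
    have := hR e he
    norm_num at h1
    linarith
  -- All points beyond index `n` are within `4 * R / (n + 4) < ε` of the finite set `E n`.
  have htb : TotallyBounded (Set.range fun n => (q n).2) := by
    refine Metric.totallyBounded_iff.2 fun ε hε => ?_
    obtain ⟨n, hn⟩ := exists_nat_gt (4 * R / ε)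
    refine ⟨(E n : Set M) ∪ (fun m => (q m).2) '' Set.Iic n,
      (E n).finite_toSet.union ((Set.finite_Iic n).image _), ?_⟩
    rintro _ ⟨m, rfl⟩
    rcases le_or_gt m n with hmn | hmn
    · exact Set.mem_iUnion₂.2 ⟨(q m).2, Or.inr ⟨m, hmn, rfl⟩, Metric.mem_ball_self hε⟩
    · obtain ⟨e, he, hd⟩ := hproj n (q m).2
      refine Set.mem_iUnion₂.2 ⟨e, Or.inl he, ?_⟩
      have h1 : ((n : ℝ) + 4) * _ ≤ 2 * _ := hmem n m hmn
      rw [hd] at h1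
      have h2 := hbd m (by omega)
      rw [div_lt_iff₀ hε] at hn
      rw [Metric.mem_ball]
      by_contra! h3
      nlinarith [(Nat.cast_nonneg n : (0 : ℝ) ≤ n)]
  have hcl : IsCompact (Set.range fun n => (q n).2) :=
    htb.isCompact_of_isClosed (isClosed_discrete _)
  exact Set.infinite_range_of_injective hinj hcl.finite_of_discrete

/-- A (V*)-set in the free space of a complete discrete space concentrates, up to `ε`, on a finite
set. -/
theorem IsVStarSet.exists_finite_concentrated [CompleteSpace M] [DiscreteTopology M]
    {Γ : Set (FreeSpace o)} (hΓ : IsVStarSet Γ) {ε : ℝ} (hε : 0 < ε) :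
    ∃ K : Set M, K.Finite ∧ ∀ γ ∈ Γ, ∀ f : Lip0 o, ‖f‖ ≤ 1 → (∀ x ∈ K, f x = 0) →
      |evalFree f γ| ≤ ε := by
  -- The `n`-th truncation changes the function by norm at most `2 * (n + 6)`, so this tolerance
  -- makes its error `ε / 2 * (1 / 2) ^ n`, with sum at most `ε`.
  have hpos : ∀ n : ℕ, 0 < ε / 2 * (1 / 2) ^ n / (2 * (n + 6)) := fun n => by positivity
  choose E hoE hE using fun n : ℕ =>
    hΓ.exists_finset_concentrated (k := n + 4) (by positivity) (hpos n)
  obtain ⟨N, hN⟩ := exists_finite_inter_relNhd E hoE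
  refine ⟨_, hN, fun γ hγ f hf hf0 => ?_⟩
  -- Truncation takes the maximum of the Lipschitz bounds of function and cutoff, so they do not
  -- accumulate: the `n`-th cutoff has `1 + 1 + (n + 4)`. The bound by `|f|` keeps each function
  -- below `dist x o`, as the next cutoff requires.
  have key : ∀ n : ℕ, ∃ g : Lip0 o, ‖g‖ ≤ n + 6 ∧ (∀ x, |g x| ≤ |f x|) ∧
      (∀ m < n, ∀ x ∉ relNhd o (E m : Set M) 2 (m + 4), g x = 0) ∧
      |evalFree f γ - evalFree g γ| ≤ ∑ m ∈ Finset.range n, ε / 2 * (1 / 2) ^ m := by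
    intro n
    induction n with
    | zero => exact ⟨f, by push_cast; linarith, fun x => le_rfl, by simp, by simp⟩
    | succ n ih =>
      obtain ⟨g, hg, hgf, hg0, hsum⟩ := ih
      have hgd : ∀ x, |g x| ≤ dist x o := fun x => (hgf x).trans <|
        (f.abs_le_norm x).trans (mul_le_of_le_one_left dist_nonneg hf)
      obtain ⟨g', hg', hgg', heq, hoff⟩ := g.exists_truncation_relNhd (E n : Set M)
        (a := 1) (k := n + 4) (C := n + 6) zero_le_one (by positivity) (by linarith) hg hgd
      rw [one_add_one_eq_two] at hoff
      refine ⟨g', by push_cast; linarith, fun x => (hgg' x).trans (hgf x), fun m hm x hx => ?_, ?_⟩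
      · rcases Nat.lt_succ_iff_lt_or_eq.1 hm with hm | rfl
        · have := hgg' x
          rw [hg0 m hm x hx, abs_zero] at this
          exact abs_nonpos_iff.1 this
        · exact hoff x hx
      · have h1 := hE n γ hγ (g - g') fun x hx => by
          rw [Lip0.sub_apply, heq x hx, sub_self]
        have h2 : ‖g - g'‖ ≤ 2 * (n + 6) := (norm_sub_le _ _).trans (by linarith)
        have h3 : ε / 2 * (1 / 2) ^ n / (2 * (n + 6)) * ‖g - g'‖ ≤ ε / 2 * (1 / 2) ^ n := by
          refine (mul_le_mul_of_nonneg_left h2 (hpos n).le).trans_eq ?_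
          field_simp
        rw [evalFree_sub] at h1
        rw [Finset.sum_range_succ]
        exact (abs_sub_le _ _ _).trans (add_le_add hsum (h1.trans h3))
  obtain ⟨g, -, hgf, hg0, hsum⟩ := key N
  -- On `K` the bound by `|f|` gives zero; every other point was cut off at some stage.
  have hg : g = 0 := by
    ext x
    by_cases hx : ∀ n < N, x ∈ relNhd o (E n : Set M) 2 (n + 4)
    · have := hgf x
      rw [hf0 x hx, abs_zero] at this
      exact abs_nonpos_iff.1 this
    · push Not at hx
      obtain ⟨n, hn, hx⟩ := hx
      exact hg0 n hn x hx
  have hz : evalFree g γ = 0 := by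
    rw [hg]
    exact γ.1.map_zero
  rw [hz, sub_zero] at hsum
  refine hsum.trans ?_
  rw [← Finset.mul_sum]
  have := sum_geometric_two_le N
  linarith [mul_le_mul_of_nonneg_left this (half_pos hε).le]

/-- Functionals vanishing on the span of the `δ(x)`, `x ∈ K`, are Lipschitz functions vanishing on
`K`, so concentration on `K` bounds the distance to this finite-dimensional span. -/
theorem IsVStarSet.totallyBounded [CompleteSpace M] [DiscreteTopology M]
    {Γ : Set (FreeSpace o)} (hΓ : IsVStarSet Γ) : TotallyBounded Γ := by
  obtain ⟨C, hC⟩ := hΓ.exists_norm_le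
  refine totallyBounded_of_finiteDimensional_approx hC fun ε hε => ?_
  obtain ⟨K, hK, hconc⟩ := hΓ.exists_finite_concentrated (half_pos hε)
  refine ⟨Submodule.span ℝ (deltaFree o '' K),
    FiniteDimensional.span_of_finite ℝ (hK.image _), fun γ hγ => ?_⟩
  have := exists_norm_sub_lt_of_dual (Submodule.span ℝ (deltaFree o '' K)) (a := γ) (half_pos hε)
    fun Φ hΦ h0 => by
      rw [evalFree_toLip0 Φ]
      exact hconc γ hγ _ ((norm_toLip0_le Φ).trans hΦ) fun x hx =>
        h0 _ (Submodule.subset_span ⟨x, hx, rfl⟩)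
  rwa [mul_div_cancel₀ ε two_ne_zero] at this

end LipFree

end

/-- If `M` is a complete metric space with the discrete topology, then the Lipschitz-free space over
`M` (for any choice of the base point `o`) has property (V*). -/
theorem corollary2p9 {M : Type*} [MetricSpace M] [CompleteSpace M] [DiscreteTopology M] (o : M) :
    LipFree.PropertyVStar (LipFree.FreeSpace o) :=
  fun _ hΓ => LipFree.isRelWeaklyCompact_of_totallyBounded hΓ.totallyBounded
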